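/- Let $H$ be a complex Hilbert space of finite dimension $n$, and let $u^*(H)$ be the real vector space of Hermitian operators on $H$, a Euclidean space with the scalar product $\langle A,B\rangle=\frac12\operatorname{Tr}(AB)$. Let $\mathcal D(H)\subset u^*(H)$ be the convex set of density states, i.e. of non-negative Hermitian operators $\rho$ with $\operatorname{Tr}\rho=1$, and let $\partial\mathcal D(H)$ be its boundary relative to its affine hull (if $n\le 1$ it is empty, and the empty set counts as a submanifold). Then $\partial\mathcal D(H)$ is a smooth (embedded) submanifold of $u^*(H)$, of some dimension, if and only if $\dim H\le 2$. For $n=2$, $\partial\mathcal D(H)$ is a smooth two-dimensional submanifold, the Bloch sphere: for every orthonormal basis of $H$, the map $$b:\mathbb R^3\to u^*(H),\qquad b(r)=\tfrac12\,(I+r_1\sigma_x+r_2\sigma_y+r_3\sigma_z),$$ where $\sigma_x,\sigma_y,\sigma_z$ are the operators given by the Pauli matrices in this basis, satisfies $\|b(r)-b(s)\|=\frac12\|r-s\|$ for all $r,s\in\mathbb R^3$, and maps the closed unit ball of $\mathbb R^3$ onto $\mathcal D(H)$ and the unit sphere onto $\partial\mathcal D(H)$. -/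

import Mathlib

open scoped ContDiff

noncomputable section

section Definitions

variable (H : Type*) [NormedAddCommGroup H] [InnerProductSpace ℂ H]

/-- The real vector space `u*(H)` of Hermitian operators on `H`. -/
def HermitianOp : Submodule ℝ (H →ₗ[ℂ] H) where
  carrier := {A | A.IsSymmetric}
  zero_mem' := LinearMap.IsSymmetric.zero
  add_mem' hA hB := hA.add hB
  smul_mem' c A hA := by
    intro x y
    have h1 : ((c • A) x) = (c : ℂ) • A x := rfl
    have h2 : ((c • A) y) = (c : ℂ) • A y := rfl
    rw [h1, h2, inner_smul_left, inner_smul_right, hA x y, Complex.conj_ofReal]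

variable {H}

theorem HermitianOp.trace_mul_self [FiniteDimensional ℂ H] (A : HermitianOp H) :
    LinearMap.trace ℂ H (A.1 * A.1) =
      ((∑ i, ‖A.1 (stdOrthonormalBasis ℂ H i)‖ ^ 2 : ℝ) : ℂ) := by
  rw [LinearMap.trace_eq_sum_inner _ (stdOrthonormalBasis ℂ H)]
  push_cast
  refine Finset.sum_congr rfl fun i _ => ?_
  rw [Module.End.mul_apply, ← A.2, inner_self_eq_norm_sq_to_K]
  rfl

/-- The scalar product `⟨A, B⟩ = (1/2) Tr(AB)` on `u*(H)`. For Hermitian `A`, `B` the trace of `AB`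
is real, so that taking the real part loses nothing. -/
abbrev HermitianOp.core [FiniteDimensional ℂ H] :
    InnerProductSpace.Core ℝ (HermitianOp H) where
  inner A B := (1 / 2) * (LinearMap.trace ℂ H (A.1 * B.1)).re
  conj_inner_symm A B := by
    simp only [conj_trivial]
    rw [LinearMap.trace_mul_comm]
  re_inner_nonneg A := by
    simp only [RCLike.re_to_real]
    rw [HermitianOp.trace_mul_self, Complex.ofReal_re]
    positivity
  add_left A B C := by
    simp only [Submodule.coe_add, add_mul, map_add, Complex.add_re]
    ring
  smul_left A B r := by
    have h : ((r • A).1 * B.1) = (r : ℂ) • (A.1 * B.1) := rfl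
    rw [h, map_smul]
    simp only [smul_eq_mul, Complex.re_ofReal_mul, conj_trivial]
    ring
  definite A h := by
    rw [HermitianOp.trace_mul_self, Complex.ofReal_re] at h
    have h0 : ∑ i, ‖A.1 (stdOrthonormalBasis ℂ H i)‖ ^ 2 = 0 := by linarith
    rw [Finset.sum_eq_zero_iff_of_nonneg (fun i _ => by positivity)] at h0
    apply Subtype.ext
    apply (stdOrthonormalBasis ℂ H).toBasis.ext
    intro i
    simpa using h0 i (Finset.mem_univ i)

instance HermitianOp.normedAddCommGroup [FiniteDimensional ℂ H] :
    NormedAddCommGroup (HermitianOp H) :=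
  @InnerProductSpace.Core.toNormedAddCommGroup ℝ (HermitianOp H) _ _ _ HermitianOp.core

instance HermitianOp.innerProductSpace [FiniteDimensional ℂ H] :
    InnerProductSpace ℝ (HermitianOp H) :=
  InnerProductSpace.ofCore HermitianOp.core.toCore

variable (H) in
/-- The set `D(H)` of density states: non-negative Hermitian operators of trace one. -/
def densityStates : Set (HermitianOp H) :=
  {ρ | ρ.1.IsPositive ∧ LinearMap.trace ℂ H ρ.1 = 1}

variable (H) in
/-- The boundary of the convex body `D(H)`, i.e. its boundary relative to the affine subspace that
it spans. -/
def densityBoundary [FiniteDimensional ℂ H] : Set (HermitianOp H) :=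
  intrinsicFrontier ℝ (densityStates H)

/-- `S` is a smooth (embedded) submanifold of dimension `k` of the normed space `E`: around each of
its points there is a smooth chart of `E`, with smooth inverse, that carries `S` to a linear
subspace of dimension `k`. -/
def IsSmoothSubmanifold {E : Type*} [NormedAddCommGroup E] [NormedSpace ℝ E] (k : ℕ) (S : Set E) :
    Prop :=
  ∀ p ∈ S, ∃ (φ : OpenPartialHomeomorph E E) (V : Submodule ℝ E),
    p ∈ φ.source ∧ ContDiffOn ℝ ∞ φ φ.source ∧ ContDiffOn ℝ ∞ φ.symm φ.target ∧
    Module.finrank ℝ V = k ∧ ∀ x ∈ φ.source, φ x ∈ V ↔ x ∈ S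

/-- The matrix `(1/2) (1 + r₀ σ_x + r₁ σ_y + r₂ σ_z)`, with the three Pauli matrices. -/
def blochMatrix (r : EuclideanSpace ℝ (Fin 3)) : Matrix (Fin 2) (Fin 2) ℂ :=
  (1 / 2 : ℂ) • (1 + (r 0 : ℂ) • !![0, 1; 1, 0] + (r 1 : ℂ) • !![0, -Complex.I; Complex.I, 0] +
    (r 2 : ℂ) • !![1, 0; 0, -1])

theorem blochMatrix_isHermitian (r : EuclideanSpace ℝ (Fin 3)) : (blochMatrix r).IsHermitian := by
  ext i j
  fin_cases i <;> fin_cases j <;> simp [blochMatrix, Matrix.conjTranspose_apply] <;> ring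

/-- The Hermitian operator with Bloch vector `r`, with respect to an orthonormal basis `e` of a
two-dimensional `H`. -/
def blochOp (e : OrthonormalBasis (Fin 2) ℂ H) (r : EuclideanSpace ℝ (Fin 3)) : HermitianOp H :=
  ⟨Matrix.toLin e.toBasis e.toBasis (blochMatrix r),
    (Matrix.isSymmetric_toLin_iff e).2 (blochMatrix_isHermitian r)⟩

end Definitions

end

/-!
The boundary of the set of density states, in each dimension `n` of `H`.

**`n ≥ 3`.** The boundary `S` is not a submanifold, because it has a corner at every pure state.
For orthonormal `e₀, e₁, e₂`, the segment from the pure state `P₀` to the pure state `P₁` consists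
of states `ρ` with `⟨e₂, ρ e₂⟩ = 0`. A state with this property lies in `S`, since the functional
`ρ ↦ ⟨e₂, ρ e₂⟩` attains its minimum over the states there without being constant
(`mem_intrinsicFrontier_of_forall_le`). If `S` were a submanifold, then `P₁ - P₀`, being a one-sided
tangent vector at `P₀`, would be the velocity of a two-sided curve in `S` through `P₀`
(`IsSmoothSubmanifold.exists_hasDerivAt_of_segment_subset`). The functional `ρ ↦ ⟨e₁, ρ e₁⟩` is
non-negative on `S` and zero at `P₀`, so its derivative along that curve would vanish; but its value
at `P₁ - P₀` is `1`.

**`n ≤ 1`.** There is at most one state, so the boundary is empty.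

**`n = 2`.** A Hermitian `2 × 2` matrix of trace one is the Bloch matrix of a unique vector `r`. Its
determinant is `(1 - ‖r‖ ^ 2) / 4`, and by the Cayley-Hamilton theorem `M = M ^ 2 + det M`, so that
`M` is non-negative precisely if `‖r‖ ≤ 1`. Up to the factor `1 / 2` the Bloch map is an affine
isometry; hence it carries the ball onto the states and the sphere onto their boundary. An
isometrically embedded sphere is a submanifold by `isSmoothSubmanifold_image_sphere`, where the
chart comes from the inverse function theorem.
-/

/-! ### Tangent vectors, relative boundaries and spheres -/

section Submanifolds

open Topology Filter Set

variable {E : Type*} [NormedAddCommGroup E]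

/-- A point of `s` at which a continuous linear functional attains its minimum over `s` lies in the
relative boundary of `s`, provided that the functional is not constant on `s`. -/
theorem mem_intrinsicFrontier_of_forall_le [NormedSpace ℝ E] {s : Set E} {x z : E} (l : E →L[ℝ] ℝ)
    (hx : x ∈ s) (hmin : ∀ y ∈ s, l x ≤ l y) (hz : z ∈ s) (hlt : l x < l z) :
    x ∈ intrinsicFrontier ℝ s := by
  have hxs := subset_affineSpan ℝ s hx
  have hzs := subset_affineSpan ℝ s hz
  refine mem_intrinsicFrontier.2 ⟨⟨x, hxs⟩, ⟨subset_closure hx, fun hint => ?_⟩, rfl⟩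
  -- the line from `x` away from `z` would stay in `s` for a while, but `l` decreases along it
  let γ : ℝ → affineSpan ℝ s := fun t =>
    ⟨AffineMap.lineMap x z t, AffineMap.lineMap_mem t hxs hzs⟩
  have hγ : Continuous γ := by
    refine Continuous.subtype_mk ?_ _
    exact AffineMap.lineMap_continuous
  have hγ0 : γ 0 = ⟨x, hxs⟩ := Subtype.ext (AffineMap.lineMap_apply_zero x z)
  have hnhds : ∀ᶠ t in 𝓝 (0 : ℝ), (γ t : E) ∈ s := by
    have h : (↑) ⁻¹' s ∈ 𝓝 (γ 0) := by rw [hγ0]; exact mem_interior_iff_mem_nhds.1 hint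
    exact hγ.continuousAt h
  obtain ⟨t, hts, ht⟩ := ((hnhds.filter_mono nhdsWithin_le_nhds).and
    (self_mem_nhdsWithin : Iio (0 : ℝ) ∈ 𝓝[<] 0)).exists
  have h1 := hmin _ hts
  have h2 : l (γ t) = t * (l z - l x) + l x := by
    simp [γ, AffineMap.lineMap_apply]
  rw [h2] at h1
  nlinarith [mul_neg_of_neg_of_pos ht (sub_pos.2 hlt)]

/-- A segment contained in a submanifold and starting at `p` gives a tangent vector `v` at `p`, so
there is also a curve in the submanifold, defined on both sides of `0`, with velocity `v` at `p`. -/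
theorem IsSmoothSubmanifold.exists_hasDerivAt_of_segment_subset [NormedSpace ℝ E]
    [FiniteDimensional ℝ E] {k : ℕ} {S : Set E} (hS : IsSmoothSubmanifold k S) {p v : E}
    (hv : ∀ t ∈ Icc (0 : ℝ) 1, p + t • v ∈ S) :
    ∃ g : ℝ → E, g 0 = p ∧ HasDerivAt g v 0 ∧ ∀ᶠ t in 𝓝 0, g t ∈ S := by
  have hp : p ∈ S := by simpa using hv 0 (by simp)
  obtain ⟨φ, V, hpφ, hφ, hφ', -, hV⟩ := hS p hp
  have hφp : φ p ∈ φ.target := φ.map_source hpφ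
  have hd : HasFDerivAt φ (fderiv ℝ φ p) p :=
    (((hφ.contDiffAt (φ.open_source.mem_nhds hpφ)).differentiableAt (by simp))).hasFDerivAt
  have hd' : HasFDerivAt φ.symm (fderiv ℝ φ.symm (φ p)) (φ p) :=
    (((hφ'.contDiffAt (φ.open_target.mem_nhds hφp)).differentiableAt (by simp))).hasFDerivAt
  set w := fderiv ℝ φ p v with hw
  have hcurve : HasDerivAt (fun t : ℝ => p + t • v) v 0 := by
    simpa using ((hasDerivAt_id (0 : ℝ)).smul_const v).const_add p
  have hcont : ∀ {u : E} {q : E} {U : Set E}, IsOpen U → q ∈ U →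
      ∀ᶠ t in 𝓝 (0 : ℝ), q + t • u ∈ U := by
    intro u q U hU hq
    have hc : ContinuousAt (fun t : ℝ => q + t • u) 0 := by fun_prop
    exact hc.eventually_mem (hU.mem_nhds (by simpa using hq))
  -- the inverse of the derivative of the chart is the derivative of the inverse chart
  have hinv : fderiv ℝ φ.symm (φ p) w = v := by
    have h1 : HasFDerivAt (φ.symm ∘ φ) ((fderiv ℝ φ.symm (φ p)).comp (fderiv ℝ φ p)) p :=
      hd'.comp p hd
    have h2 : φ.symm ∘ φ =ᶠ[𝓝 p] id := by
      filter_upwards [φ.open_source.mem_nhds hpφ] with x hx using φ.left_inv hx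
    have h3 := h1.unique ((hasFDerivAt_id p).congr_of_eventuallyEq h2)
    simpa using DFunLike.congr_fun h3 v
  have hφpV : φ p ∈ V := (hV p hpφ).2 hp
  -- a one-sided tangent vector of the linear subspace `V` lies in it
  have hwV : w ∈ V := by
    have h1 : HasDerivAt (fun t : ℝ => φ (p + t • v)) w 0 := by
      refine HasFDerivAt.comp_hasDerivAt (0 : ℝ) ?_ hcurve
      simpa using hd
    have h2 := h1.tendsto_slope_zero_right
    refine V.closed_of_finiteDimensional.mem_of_tendsto h2 ?_
    filter_upwards [(hcont φ.open_source hpφ).filter_mono nhdsWithin_le_nhds,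
      Ioc_mem_nhdsGT (zero_lt_one (α := ℝ))] with t ht ht'
    refine V.smul_mem _ (V.sub_mem ?_ ?_)
    · simpa using (hV _ ht).2 (hv t ⟨ht'.1.le, ht'.2⟩)
    · simpa using hφpV
  refine ⟨fun t => φ.symm (φ p + t • w), by simp [φ.left_inv hpφ], ?_, ?_⟩
  · have h1 : HasDerivAt (fun t : ℝ => φ p + t • w) w 0 := by
      simpa using ((hasDerivAt_id (0 : ℝ)).smul_const w).const_add (φ p)
    rw [← hinv]
    refine HasFDerivAt.comp_hasDerivAt (0 : ℝ) ?_ h1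
    simpa using hd'
  · filter_upwards [hcont φ.open_target hφp] with t ht
    rw [← hV _ (φ.map_target ht), φ.right_inv ht]
    exact V.add_mem hφpV (V.smul_mem _ hwV)

/-- First-order condition for a linear functional that attains its minimum over a submanifold at
`p`: it vanishes on the direction of every segment of the submanifold that starts at `p`. -/
theorem IsSmoothSubmanifold.apply_eq_zero_of_segment_subset [NormedSpace ℝ E]
    [FiniteDimensional ℝ E] {k : ℕ} {S : Set E} (hS : IsSmoothSubmanifold k S) {p v : E}
    (hv : ∀ t ∈ Icc (0 : ℝ) 1, p + t • v ∈ S) (l : E →L[ℝ] ℝ) (hl : ∀ x ∈ S, l p ≤ l x) :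
    l v = 0 := by
  obtain ⟨g, hg0, hg, hgS⟩ := hS.exists_hasDerivAt_of_segment_subset hv
  have hmin : IsLocalMin (fun t => l (g t)) 0 := by
    filter_upwards [hgS] with t ht
    simpa only [hg0] using hl _ ht
  exact hmin.hasDerivAt_eq_zero (l.hasFDerivAt.comp_hasDerivAt (0 : ℝ) hg)

/-- The isometric image of an `n`-dimensional sphere in a Euclidean space is a submanifold, in any
codimension. Near a point `c + q` of it, the chart keeps the component of `x - c` orthogonal to `q`
and replaces the component along `q` by a multiple of `‖x - c‖ ^ 2 - r ^ 2`; the linear subspace is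
the orthogonal complement of `q` in the image of `L`. -/
theorem isSmoothSubmanifold_image_sphere [InnerProductSpace ℝ E] [FiniteDimensional ℝ E]
    {F : Type*} [NormedAddCommGroup F] [InnerProductSpace ℝ F] {n : ℕ}
    (hF : Module.finrank ℝ F = n + 1) (L : F →ₗᵢ[ℝ] E) (c : E) {r : ℝ} (hr : 0 < r) :
    IsSmoothSubmanifold n ((fun x => c + L x) '' Metric.sphere (0 : F) r) := by
  rintro _ ⟨q₀, hq₀, rfl⟩
  have hq₀n : ‖q₀‖ = r := by simpa using hq₀
  set q : E := L q₀ with hq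
  have hqn : ‖q‖ = r := by rw [hq, L.norm_map, hq₀n]
  have hqq : inner ℝ q q = r ^ 2 := by rw [real_inner_self_eq_norm_sq, hqn]
  have hr2 : r ^ 2 ≠ 0 := by positivity
  -- replace the component of `x - c` along `q` by `‖x - c‖ ^ 2 - r ^ 2`
  let G : E → E := fun x =>
    (x - c) - (inner ℝ q (x - c) / r ^ 2) • q + (‖x - c‖ ^ 2 - r ^ 2) • q
  have hG : ContDiff ℝ ∞ G := by
    have h1 : ContDiff ℝ ∞ fun x : E => x - c := contDiff_id.sub contDiff_const
    have h2 : ContDiff ℝ ∞ fun x : E => inner ℝ q (x - c) := contDiff_const.inner ℝ h1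
    exact (h1.sub ((h2.div_const _).smul contDiff_const)).add
      (((h1.norm_sq ℝ).sub contDiff_const).smul contDiff_const)
  let G' : E → E →L[ℝ] E := fun x =>
    ContinuousLinearMap.id ℝ E - ((r ^ 2)⁻¹ • innerSL ℝ q).smulRight q +
      ((2 : ℝ) • innerSL ℝ (x - c)).smulRight q
  have hG' : ∀ x, HasFDerivAt G (G' x) x := by
    intro x
    have h1 : HasFDerivAt (fun x : E => x - c) (ContinuousLinearMap.id ℝ E) x :=
      (hasFDerivAt_id x).sub_const c
    have h2 : HasFDerivAt (fun x : E => inner ℝ q (x - c) / r ^ 2) ((r ^ 2)⁻¹ • innerSL ℝ q) x := by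
      have := (((innerSL ℝ q).hasFDerivAt (x := x - c)).comp x h1).const_mul ((r ^ 2)⁻¹)
      refine this.congr_of_eventuallyEq (Eventually.of_forall fun y => ?_)
      simp [div_eq_inv_mul]
    have h3 : HasFDerivAt (fun x : E => ‖x - c‖ ^ 2 - r ^ 2) ((2 : ℝ) • innerSL ℝ (x - c)) x := by
      have := (h1.norm_sq).sub_const (r ^ 2)
      refine this.congr_fderiv ?_
      ext y; simp
    exact (h1.sub (h2.smul_const q)).add (h3.smul_const q)
  -- away from the hyperplane through `c` orthogonal to `q`, this map is a local diffeomorphism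
  have hinj : ∀ x, inner ℝ q (x - c) ≠ 0 → ∃ e : E ≃L[ℝ] E, (e : E →L[ℝ] E) = G' x := by
    intro x hx
    have hker : Function.Injective (G' x : E →ₗ[ℝ] E) := by
      rw [← LinearMap.ker_eq_bot, LinearMap.ker_eq_bot']
      intro h hh
      have hh' : h - ((r ^ 2)⁻¹ * inner ℝ q h) • q + (2 * inner ℝ (x - c) h) • q = 0 := by
        simpa [G', -map_sub] using hh
      have h1 : inner ℝ (x - c) h = 0 := by
        have := congrArg (inner ℝ q) hh'
        simp only [inner_add_right, inner_sub_right, inner_smul_right, hqq, inner_zero_right] at this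
        have h3 : 2 * inner ℝ (x - c) h * r ^ 2 = 0 := by
          rw [← this]; simp only [mul_assoc, inner_sub_left]; field_simp; ring
        rcases mul_eq_zero.1 h3 with h3 | h3
        · linarith
        · exact absurd h3 hr2
      have h2 : h = ((r ^ 2)⁻¹ * inner ℝ q h) • q := by
        rw [h1] at hh'
        simpa [sub_eq_zero] using hh'
      have h3 : (r ^ 2)⁻¹ * inner ℝ q h = 0 := by
        rw [h2, inner_smul_right, real_inner_comm q (x - c)] at h1
        exact (mul_eq_zero.1 h1).resolve_right hx
      rw [h2, h3, zero_smul]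
    exact ⟨(LinearEquiv.ofInjectiveEndo _ hker).toContinuousLinearEquiv, by ext; rfl⟩
  have hqpos : inner ℝ q (c + q - c) ≠ 0 := by rw [add_sub_cancel_left, hqq]; exact hr2
  obtain ⟨e, he⟩ := hinj (c + q) hqpos
  have hn : (∞ : WithTop ℕ∞) ≠ 0 := by simp
  have hGe : HasFDerivAt G (e : E →L[ℝ] E) (c + q) := by rw [he]; exact hG' _
  let Φ := hG.contDiffAt.toOpenPartialHomeomorph G hGe hn
  have hopen : IsOpen {x : E | inner ℝ q (x - c) ≠ 0} :=
    isOpen_ne_fun (by fun_prop) continuous_const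
  let φ := Φ.restrOpen _ hopen
  have hsrc : φ.source = Φ.source ∩ {x : E | inner ℝ q (x - c) ≠ 0} := Φ.restrOpen_source _ _
  let V₀ : Submodule ℝ F := (Submodule.span ℝ {q₀})ᗮ
  have hq₀0 : q₀ ≠ 0 := norm_ne_zero_iff.1 (by rw [hq₀n]; exact hr.ne')
  have : Fact (Module.finrank ℝ F = n + 1) := ⟨hF⟩
  refine ⟨φ, V₀.map L.toLinearMap, ?_, hG.contDiffOn, ?_, ?_, ?_⟩
  · rw [hsrc]
    exact ⟨hG.contDiffAt.mem_toOpenPartialHomeomorph_source hGe hn, hqpos⟩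
  · intro y hy
    have hy' := φ.map_target hy
    rw [hsrc] at hy'
    obtain ⟨e', he'⟩ := hinj _ hy'.2
    refine (φ.contDiffAt_symm (f₀' := e') hy ?_ hG.contDiffAt).contDiffWithinAt
    rw [he']; exact hG' _
  · rw [← (V₀.equivMapOfInjective L.toLinearMap L.injective).finrank_eq]
    exact Submodule.finrank_orthogonal_span_singleton hq₀0
  · intro x _
    change G x ∈ _ ↔ _
    have hGq : inner ℝ q (G x) = (‖x - c‖ ^ 2 - r ^ 2) * r ^ 2 := by
      simp only [G, inner_add_right, inner_sub_right, inner_smul_right, hqq]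
      field_simp
      ring
    constructor
    · rintro ⟨y, hy, hyG⟩
      have hyG' : L y = G x := hyG
      have hxn : ‖x - c‖ ^ 2 = r ^ 2 := by
        have h1 : inner ℝ q (G x) = 0 := by
          rw [← hyG', hq, L.inner_map_map]
          exact Submodule.mem_orthogonal_singleton_iff_inner_right.1 hy
        rw [hGq] at h1
        linarith [(mul_eq_zero.1 h1).resolve_right hr2]
      have hxL : L (y + (inner ℝ q (x - c) / r ^ 2) • q₀) = x - c := by
        rw [map_add, map_smul, hyG', ← hq]
        simp [G, hxn]
      refine ⟨y + (inner ℝ q (x - c) / r ^ 2) • q₀, ?_, by simp only [hxL]; abel⟩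
      rw [mem_sphere_zero_iff_norm, ← L.norm_map, hxL]
      exact (pow_left_inj₀ (norm_nonneg _) hr.le two_ne_zero).1 hxn
    · rintro ⟨y, hy, rfl⟩
      have hyn : ‖y‖ = r := by simpa using hy
      refine ⟨y - (inner ℝ q₀ y / r ^ 2) • q₀, ?_, ?_⟩
      · refine Submodule.mem_orthogonal_singleton_iff_inner_right.2 ?_
        rw [inner_sub_right, inner_smul_right, real_inner_self_eq_norm_sq, hq₀n]
        field_simp
        ring
      · simp [G, hyn, hq]

end Submanifolds

/-! ### Density states -/

section DensityStates

open Topology Filter Set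

variable {H : Type*} [NormedAddCommGroup H] [InnerProductSpace ℂ H] [FiniteDimensional ℂ H]

/-- The value `⟨x, A x⟩` of the quadratic form of a Hermitian operator `A` at a fixed vector `x`, as a
linear functional of `A`. It is real, so only the real part is recorded. -/
noncomputable def HermitianOp.expectation (x : H) : HermitianOp H →L[ℝ] ℝ :=
  LinearMap.toContinuousLinearMap
    { toFun := fun A => (inner ℂ (A.1 x) x).re
      map_add' := fun A B => by
        rw [Submodule.coe_add, LinearMap.add_apply, inner_add_left, Complex.add_re]
      map_smul' := fun t A => by
        have h : (t • A).1 x = (t : ℂ) • A.1 x := rfl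
        rw [h, inner_smul_left, Complex.conj_ofReal, Complex.re_ofReal_mul]
        rfl }

theorem HermitianOp.expectation_apply (x : H) (A : HermitianOp H) :
    expectation x A = (inner ℂ (A.1 x) x).re := rfl

theorem isClosed_densityStates : IsClosed (densityStates H) := by
  let T : HermitianOp H →ₗ[ℝ] ℂ :=
    ((LinearMap.trace ℂ H).restrictScalars ℝ).comp (HermitianOp H).subtype
  have h : densityStates H =
      (⋂ x : H, {A | 0 ≤ HermitianOp.expectation x A}) ∩ {A | T A = 1} := by
    ext A
    simp only [densityStates, mem_inter_iff, mem_iInter, mem_ofPred_eq]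
    exact and_congr_left fun _ => ⟨fun h => h.2, fun h => ⟨A.2, h⟩⟩
  rw [h]
  exact (isClosed_iInter fun x => isClosed_le continuous_const
    (HermitianOp.expectation x).continuous).inter
    (isClosed_eq (LinearMap.continuous_of_finiteDimensional (E := HermitianOp H) T)
      continuous_const)

theorem densityBoundary_subset : densityBoundary H ⊆ densityStates H :=
  intrinsicFrontier_subset isClosed_densityStates

theorem expectation_nonneg {ρ : HermitianOp H} (hρ : ρ ∈ densityStates H) (x : H) :
    0 ≤ HermitianOp.expectation x ρ :=
  hρ.1.2 x

/-- The operator `|x⟩⟨x|`, which is a density state, called pure, if `x` is a unit vector. -/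
noncomputable def pureState (x : H) : HermitianOp H :=
  ⟨(InnerProductSpace.rankOne ℂ x x : H →L[ℂ] H), InnerProductSpace.isSymmetric_rankOne_self x⟩

theorem expectation_pureState (x y : H) :
    HermitianOp.expectation y (pureState x) = ‖inner ℂ x y‖ ^ 2 := by
  have h : (pureState x).1 y = inner ℂ x y • x := rfl
  rw [HermitianOp.expectation_apply, h, inner_smul_left, Complex.conj_mul']
  norm_cast

theorem pureState_mem_densityStates {x : H} (hx : ‖x‖ = 1) : pureState x ∈ densityStates H := by
  refine ⟨(ContinuousLinearMap.isPositive_toLinearMap_iff _).2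
    (InnerProductSpace.isPositive_rankOne_self x), ?_⟩
  refine (InnerProductSpace.trace_rankOne x x).trans ?_
  rw [inner_self_eq_norm_sq_to_K, hx]
  simp

theorem convex_densityStates : Convex ℝ (densityStates H) := by
  intro A hA B hB a b ha hb hab
  refine ⟨⟨(a • A + b • B).2, fun x => ?_⟩, ?_⟩
  · change 0 ≤ HermitianOp.expectation x (a • A + b • B)
    rw [map_add, map_smul, map_smul]
    have := expectation_nonneg hA x
    have := expectation_nonneg hB x
    simp only [smul_eq_mul]
    positivity
  · have h : (a • A + b • B).1 = (a : ℂ) • A.1 + (b : ℂ) • B.1 := rfl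
    rw [h, map_add, map_smul, map_smul, hA.2, hB.2]
    simp only [smul_eq_mul, mul_one]
    exact_mod_cast hab

/-- A density state that is not positive definite lies in the boundary. -/
theorem mem_densityBoundary_of_expectation_eq_zero {ρ : HermitianOp H} (hρ : ρ ∈ densityStates H)
    {x : H} (hx : ‖x‖ = 1) (h : HermitianOp.expectation x ρ = 0) : ρ ∈ densityBoundary H := by
  refine mem_intrinsicFrontier_of_forall_le (HermitianOp.expectation x) hρ
    (fun σ hσ => h ▸ expectation_nonneg hσ x) (pureState_mem_densityStates hx) ?_
  rw [h, expectation_pureState, inner_self_eq_norm_sq_to_K, hx]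
  simp

theorem not_isSmoothSubmanifold_densityBoundary (hH : 3 ≤ Module.finrank ℂ H) (k : ℕ) :
    ¬ IsSmoothSubmanifold k (densityBoundary H) := by
  intro hS
  let e := stdOrthonormalBasis ℂ H
  let i : Fin 3 → Fin (Module.finrank ℂ H) := Fin.castLE hH
  have hi : ∀ {a b : Fin 3}, a ≠ b → inner ℂ (e (i a)) (e (i b)) = 0 := fun h =>
    e.orthonormal.2 fun h' => h (Fin.castLE_injective hH h')
  have he : ∀ a, ‖e (i a)‖ = 1 := fun a => e.orthonormal.1 _
  have h01 : HermitianOp.expectation (e (i 1)) (pureState (e (i 0))) = 0 := by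
    rw [expectation_pureState, hi (by decide)]; simp
  have h11 : HermitianOp.expectation (e (i 1)) (pureState (e (i 1))) = 1 := by
    rw [expectation_pureState, inner_self_eq_norm_sq_to_K, he]; simp
  -- the states on this segment have rank at most two and annihilate `e (i 2)`
  have hseg : ∀ t ∈ Icc (0 : ℝ) 1, pureState (e (i 0)) +
      t • (pureState (e (i 1)) - pureState (e (i 0))) ∈ densityBoundary H := by
    intro t ht
    refine mem_densityBoundary_of_expectation_eq_zero
      (convex_densityStates.add_smul_sub_mem (pureState_mem_densityStates (he 0))
        (pureState_mem_densityStates (he 1)) ht) (he 2) ?_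
    rw [map_add, map_smul, map_sub, expectation_pureState, expectation_pureState,
      hi (by decide), hi (by decide)]
    simp
  have h := hS.apply_eq_zero_of_segment_subset hseg (HermitianOp.expectation (e (i 1)))
    fun ρ hρ => h01 ▸ expectation_nonneg (densityBoundary_subset hρ) _
  rw [map_sub, h01, h11] at h
  norm_num at h

theorem densityBoundary_eq_empty (hH : Module.finrank ℂ H ≤ 1) : densityBoundary H = ∅ := by
  have hsub : (densityStates H).Subsingleton := by
    intro A hA B hB
    rcases Nat.le_one_iff_eq_zero_or_eq_one.1 hH with h0 | h1
    · have := Module.finrank_zero_iff.1 h0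
      exact Subtype.ext (LinearMap.ext fun x => Subsingleton.elim _ _)
    · have hid : ∀ C ∈ densityStates H, C.1 = LinearMap.id := by
        intro C hC
        obtain ⟨c, hc, -⟩ := C.1.existsUnique_eq_smul_id_of_finrank_eq_one h1
        have hC2 := hC.2
        rw [hc, map_smul, LinearMap.trace_id, h1] at hC2
        have hc1 : c = 1 := by simpa using hC2
        rw [hc, hc1, one_smul]
      exact Subtype.ext ((hid A hA).trans (hid B hB).symm)
  rcases hsub.eq_empty_or_singleton with h | ⟨A, h⟩
  · rw [densityBoundary, h, intrinsicFrontier_empty]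
  · rw [densityBoundary, h, intrinsicFrontier_singleton]

end DensityStates

/-! ### The Bloch ball -/

section Bloch

open Topology Filter Set

open scoped ComplexOrder

theorem blochMatrix_eq (r : EuclideanSpace ℝ (Fin 3)) :
    blochMatrix r = !![((1 + r 2) / 2 : ℂ), (r 0 - r 1 * Complex.I) / 2;
      (r 0 + r 1 * Complex.I) / 2, (1 - r 2) / 2] := by
  ext i j
  fin_cases i <;> fin_cases j <;> simp [blochMatrix] <;> ring

theorem trace_blochMatrix (r : EuclideanSpace ℝ (Fin 3)) : (blochMatrix r).trace = 1 := by
  rw [blochMatrix_eq, Matrix.trace_fin_two_of]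
  ring

theorem det_blochMatrix (r : EuclideanSpace ℝ (Fin 3)) :
    (blochMatrix r).det = (((1 - ‖r‖ ^ 2) / 4 : ℝ) : ℂ) := by
  rw [blochMatrix_eq, Matrix.det_fin_two_of, EuclideanSpace.norm_sq_eq, Fin.sum_univ_three]
  simp only [Real.norm_eq_abs, sq_abs]
  push_cast
  linear_combination ((r 1 : ℂ) ^ 2 / 4) * Complex.I_sq

/-- By the Cayley-Hamilton theorem such a matrix is the sum `Mᴴ * M + det M`. -/
theorem Matrix.posSemidef_of_trace_eq_one_of_det_nonneg {M : Matrix (Fin 2) (Fin 2) ℂ}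
    (hM : M.IsHermitian) (htr : M.trace = 1) (hdet : 0 ≤ M.det) : M.PosSemidef := by
  have h : M = M.conjTranspose * M + M.det • (1 : Matrix (Fin 2) (Fin 2) ℂ) := by
    rw [hM.eq]
    rw [Matrix.trace_fin_two] at htr
    ext i j
    fin_cases i <;> fin_cases j <;>
      simp [Matrix.mul_apply, Fin.sum_univ_two, Matrix.det_fin_two]
    · linear_combination -M 0 0 * htr
    · linear_combination -M 0 1 * htr
    · linear_combination -M 1 0 * htr
    · linear_combination -M 1 1 * htr
  rw [h]
  exact (Matrix.posSemidef_conjTranspose_mul_self M).add (Matrix.PosSemidef.one.smul hdet)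

theorem blochMatrix_posSemidef_iff (r : EuclideanSpace ℝ (Fin 3)) :
    (blochMatrix r).PosSemidef ↔ ‖r‖ ≤ 1 := by
  have hdet : 0 ≤ (blochMatrix r).det ↔ ‖r‖ ≤ 1 := by
    rw [det_blochMatrix, Complex.zero_le_real, ← sq_le_one_iff₀ (norm_nonneg r)]
    constructor <;> intro h <;> linarith
  rw [← hdet]
  exact ⟨fun h => h.det_nonneg, Matrix.posSemidef_of_trace_eq_one_of_det_nonneg
    (blochMatrix_isHermitian r) (trace_blochMatrix r)⟩

theorem exists_eq_blochMatrix {M : Matrix (Fin 2) (Fin 2) ℂ} (hM : M.IsHermitian)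
    (htr : M.trace = 1) : ∃ r, M = blochMatrix r := by
  rw [Matrix.trace_fin_two] at htr
  have h00 : ((M 0 0).re : ℂ) = M 0 0 := hM.coe_re_apply_self 0
  have h11 : ((M 1 1).re : ℂ) = M 1 1 := hM.coe_re_apply_self 1
  have h01 : ((M 0 1).re : ℂ) + (M 0 1).im * Complex.I = M 0 1 := Complex.re_add_im _
  have h10 : ((M 0 1).re : ℂ) - (M 0 1).im * Complex.I = M 1 0 := by
    rw [← hM.apply 1 0]
    apply Complex.ext <;> simp
  refine ⟨!₂[2 * (M 0 1).re, -2 * (M 0 1).im, (M 0 0).re - (M 1 1).re], ?_⟩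
  rw [blochMatrix_eq]
  ext i j
  fin_cases i <;> fin_cases j <;> simp
  · linear_combination htr / 2 - h00 / 2 + h11 / 2
  · linear_combination -h01
  · linear_combination -h10
  · linear_combination htr / 2 + h00 / 2 - h11 / 2

variable {H : Type*} [NormedAddCommGroup H] [InnerProductSpace ℂ H]

theorem blochOp_image_closedBall (e : OrthonormalBasis (Fin 2) ℂ H) :
    blochOp e '' Metric.closedBall 0 1 = densityStates H := by
  have hpos : ∀ r, (blochOp e r).1.IsPositive ↔ ‖r‖ ≤ 1 := by
    intro r
    rw [← LinearMap.posSemidef_toMatrix_iff e, blochOp, LinearMap.toMatrix_toLin,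
      blochMatrix_posSemidef_iff]
  have htr : ∀ r, LinearMap.trace ℂ H (blochOp e r).1 = 1 := fun r =>
    (Matrix.trace_toLin_eq _ _).trans (trace_blochMatrix r)
  ext ρ
  constructor
  · rintro ⟨r, hr, rfl⟩
    exact ⟨(hpos r).2 (by simpa using hr), htr r⟩
  · intro hρ
    have h1 := ((LinearMap.posSemidef_toMatrix_iff e).2 hρ.1).isHermitian
    have h2 := hρ.2
    rw [LinearMap.trace_eq_matrix_trace ℂ e.toBasis] at h2
    obtain ⟨r, hr⟩ := exists_eq_blochMatrix h1 h2
    have hρr : blochOp e r = ρ := Subtype.ext <| by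
      change Matrix.toLin e.toBasis e.toBasis (blochMatrix r) = ρ.1
      rw [← hr, Matrix.toLin_toMatrix]
    refine ⟨r, ?_, hρr⟩
    rw [mem_closedBall_zero_iff, ← hpos, hρr]
    exact hρ.1

variable [FiniteDimensional ℂ H]

theorem dist_blochOp (e : OrthonormalBasis (Fin 2) ℂ H) (r s : EuclideanSpace ℝ (Fin 3)) :
    dist (blochOp e r) (blochOp e s) = dist r s / 2 := by
  have h1 : ‖blochOp e r - blochOp e s‖ ^ 2 = (‖r - s‖ / 2) ^ 2 := by
    rw [← real_inner_self_eq_norm_sq]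
    change (1 / 2) * (LinearMap.trace ℂ H ((Matrix.toLin e.toBasis e.toBasis (blochMatrix r) -
      Matrix.toLin e.toBasis e.toBasis (blochMatrix s)) *
      (Matrix.toLin e.toBasis e.toBasis (blochMatrix r) -
      Matrix.toLin e.toBasis e.toBasis (blochMatrix s)))).re = _
    rw [← map_sub, Module.End.mul_eq_comp, ← Matrix.toLin_mul, Matrix.trace_toLin_eq,
      div_pow, EuclideanSpace.norm_sq_eq, Fin.sum_univ_three]
    simp only [Real.norm_eq_abs, sq_abs]
    simp [blochMatrix_eq, Matrix.trace_fin_two]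
    ring
  rw [dist_eq_norm, dist_eq_norm]
  exact (pow_left_inj₀ (norm_nonneg _) (by positivity) two_ne_zero).1 h1

/-- The linear part of the Bloch map, rescaled by the factor `2` that makes it isometric. -/
noncomputable def blochIsometry (e : OrthonormalBasis (Fin 2) ℂ H) :
    EuclideanSpace ℝ (Fin 3) →ₗᵢ[ℝ] HermitianOp H where
  toFun r := blochOp e ((2 : ℝ) • r) - blochOp e 0
  map_add' r s := by
    have h : blochMatrix ((2 : ℝ) • (r + s)) - blochMatrix 0 =
        (blochMatrix ((2 : ℝ) • r) - blochMatrix 0) +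
          (blochMatrix ((2 : ℝ) • s) - blochMatrix 0) := by
      ext i j
      fin_cases i <;> fin_cases j <;> simp [blochMatrix_eq] <;> ring
    have h' := congrArg (Matrix.toLin e.toBasis e.toBasis) h
    rw [map_add, map_sub, map_sub, map_sub] at h'
    exact Subtype.ext h'
  map_smul' t r := by
    have h : blochMatrix ((2 : ℝ) • t • r) - blochMatrix 0 =
        (t : ℂ) • (blochMatrix ((2 : ℝ) • r) - blochMatrix 0) := by
      ext i j
      fin_cases i <;> fin_cases j <;> simp [blochMatrix_eq] <;> ring
    have h' := congrArg (Matrix.toLin e.toBasis e.toBasis) h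
    rw [map_smul, map_sub, map_sub] at h'
    exact Subtype.ext h'
  norm_map' r := by
    change ‖blochOp e ((2 : ℝ) • r) - blochOp e 0‖ = ‖r‖
    rw [← dist_eq_norm, dist_blochOp, dist_zero_right, norm_smul]
    simp

/-- The Bloch map in terms of `blochIsometry`: the change of scale replaces a set `s` of Bloch
vectors by `t = s / 2`. -/
theorem blochOp_image_eq (e : OrthonormalBasis (Fin 2) ℂ H) {s t : Set (EuclideanSpace ℝ (Fin 3))}
    (hst : ∀ r, r ∈ t ↔ (2 : ℝ) • r ∈ s) :
    blochOp e '' s = (fun r => blochOp e 0 + blochIsometry e r) '' t := by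
  have h : ∀ r, blochOp e 0 + blochIsometry e r = blochOp e ((2 : ℝ) • r) := fun r =>
    add_sub_cancel _ _
  ext A
  constructor
  · rintro ⟨r, hr, rfl⟩
    have h2 : (2 : ℝ) • (2⁻¹ : ℝ) • r = r := smul_inv_smul₀ two_ne_zero r
    exact ⟨(2⁻¹ : ℝ) • r, (hst _).2 (by rwa [h2]), by simp only [h, h2]⟩
  · rintro ⟨r, hr, rfl⟩
    exact ⟨(2 : ℝ) • r, (hst r).1 hr, (h r).symm⟩

theorem blochOp_image_sphere_eq (e : OrthonormalBasis (Fin 2) ℂ H) :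
    blochOp e '' Metric.sphere 0 1 =
      (fun r => blochOp e 0 + blochIsometry e r) '' Metric.sphere 0 (1 / 2) := by
  refine blochOp_image_eq e fun r => ?_
  rw [mem_sphere_zero_iff_norm, mem_sphere_zero_iff_norm, norm_smul, Real.norm_ofNat]
  constructor <;> intro h <;> linarith

theorem intrinsicFrontier_closedBall_zero {F : Type*} [NormedAddCommGroup F]
    [InnerProductSpace ℝ F] {r : ℝ} (hr : 0 < r) :
    intrinsicFrontier ℝ (Metric.closedBall (0 : F) r) = Metric.sphere 0 r := by
  refine Subset.antisymm ?_ fun x hx => ?_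
  · rw [← frontier_closedBall (0 : F) hr.ne']
    exact intrinsicFrontier_subset_frontier
  · have hxr : ‖x‖ = r := by simpa using hx
    refine mem_intrinsicFrontier_of_forall_le (z := 0) (-innerSL ℝ x)
      (Metric.sphere_subset_closedBall hx) (fun y hy => ?_) (by simp [hr.le]) ?_
    · have h1 := real_inner_le_norm x y
      have hy' : ‖y‖ ≤ r := by simpa using hy
      have h2 : inner ℝ x x = r ^ 2 := by rw [real_inner_self_eq_norm_sq, hxr]
      simp only [neg_apply, innerSL_apply_apply, h2]
      rw [hxr] at h1
      nlinarith [mul_le_mul_of_nonneg_left hy' hr.le]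
    · simp [hxr, hr]

theorem blochOp_image_sphere (e : OrthonormalBasis (Fin 2) ℂ H) :
    blochOp e '' Metric.sphere 0 1 = densityBoundary H := by
  have hball : blochOp e '' Metric.closedBall 0 1 =
      (fun r => blochOp e 0 + blochIsometry e r) '' Metric.closedBall 0 (1 / 2) := by
    refine blochOp_image_eq e fun r => ?_
    rw [mem_closedBall_zero_iff, mem_closedBall_zero_iff, norm_smul, Real.norm_ofNat]
    constructor <;> intro h <;> linarith
  let b : EuclideanSpace ℝ (Fin 3) →ᵃⁱ[ℝ] HermitianOp H :=
    (AffineIsometryEquiv.constVAdd ℝ (HermitianOp H) (blochOp e 0)).toAffineIsometry.comp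
      (blochIsometry e).toAffineIsometry
  have hb : ⇑b = fun r => blochOp e 0 + blochIsometry e r := rfl
  rw [densityBoundary, ← blochOp_image_closedBall e, hball, blochOp_image_sphere_eq,
    ← hb, b.intrinsicFrontier_image, intrinsicFrontier_closedBall_zero (by norm_num)]

theorem isSmoothSubmanifold_densityBoundary (hH : Module.finrank ℂ H = 2) :
    IsSmoothSubmanifold 2 (densityBoundary H) := by
  let e : OrthonormalBasis (Fin 2) ℂ H := (stdOrthonormalBasis ℂ H).reindex (finCongr hH)
  rw [← blochOp_image_sphere e, blochOp_image_sphere_eq]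
  exact isSmoothSubmanifold_image_sphere (by simp) _ _ (by norm_num)

end Bloch

/-! ### Smoothness of the boundary -/

theorem mainTheorem9 (H : Type*) [NormedAddCommGroup H] [InnerProductSpace ℂ H]
    [FiniteDimensional ℂ H] :
    ((∃ k : ℕ, IsSmoothSubmanifold k (densityBoundary H)) ↔ Module.finrank ℂ H ≤ 2) ∧
    (Module.finrank ℂ H = 2 →
      IsSmoothSubmanifold 2 (densityBoundary H) ∧
      ∀ e : OrthonormalBasis (Fin 2) ℂ H,
        (∀ r s, dist (blochOp e r) (blochOp e s) = dist r s / 2) ∧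
        blochOp e '' Metric.closedBall 0 1 = densityStates H ∧
        blochOp e '' Metric.sphere 0 1 = densityBoundary H) := by
  refine ⟨⟨fun ⟨k, hk⟩ => ?_, fun h => ?_⟩, fun h => ⟨isSmoothSubmanifold_densityBoundary h,
    fun e => ⟨dist_blochOp e, blochOp_image_closedBall e, blochOp_image_sphere e⟩⟩⟩
  · by_contra h
    exact not_isSmoothSubmanifold_densityBoundary (by omega) k hk
  · rcases Nat.lt_or_ge (Module.finrank ℂ H) 2 with h1 | h2
    · refine ⟨0, ?_⟩
      rw [densityBoundary_eq_empty (by omega)]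
      exact fun p hp => hp.elim
    · exact ⟨2, isSmoothSubmanifold_densityBoundary (le_antisymm h h2)⟩
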